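/- Let $E$ and $F$ be real Banach spaces, let $L\subset E$ be a closed linear subspace, and write $Q_L:E\to E/L$ for the quotient map, where $E/L$ has the quotient norm. Let $T:E\to F$ be a bounded linear operator with the Kato property for $L$: for every closed finite-codimensional linear subspace $W\subset E$ with $L\subset W$ and every $\varepsilon>0$ there exists $u\in W\setminus L$ such that $\|T(u)\|\le\varepsilon\|Q_L(u)\|$. Let $R\subset E$ be a proper dense operator range, that is, a dense linear subspace $R\neq E$ such that $R=A(G)$ for some real Banach space $G$ and some bounded linear operator $A:G\to E$. Assume that $R\cap L=\{0\}$ and that the dual space $(E/L)^*$ is separable in its weak$^*$ topology. Then there exists a closed linear subspace $E_1\subset E$ such that (a) $L\subset E_1$; (b) $E/E_1$ is separable and infinite-dimensional; (c) $E_1\cap R=\{0\}$; (d) $\overline{T(E_1)}=\overline{T(E)}$. -/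

import Mathlib

universe u v

/-- `T` has the Kato property for the subspace `L`: for every closed finite-codimensional
subspace `W` containing `L` and every `ε > 0` there is `u ∈ W \ L` with `‖T u‖ ≤ ε ‖Q_L u‖`,
where `Q_L : E → E ⧸ L` is the quotient map and `E ⧸ L` carries the quotient norm. -/
def HasKatoPropertyFor {E : Type u} {F : Type v}
    [NormedAddCommGroup E] [NormedSpace ℝ E] [NormedAddCommGroup F] [NormedSpace ℝ F]
    (T : E →L[ℝ] F) (L : Submodule ℝ E) : Prop :=
  ∀ W : Submodule ℝ E, IsClosed (W : Set E) → FiniteDimensional ℝ (E ⧸ W) → L ≤ W →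
    ∀ ε : ℝ, 0 < ε → ∃ u : E, u ∈ W ∧ u ∉ L ∧ ‖T u‖ ≤ ε * ‖L.mkQ u‖

/-- `R` is an operator range in `E`: the range of a bounded linear operator from a Banach space.
Taking the source in the universe of `E` is no restriction: an operator `A : G → E` has the same
range as the induced injective operator on `G ⧸ ker A`, whose source is in bijection with a
subset of `E`. -/
def IsOperatorRange {E : Type u} [NormedAddCommGroup E] [NormedSpace ℝ E]
    (R : Submodule ℝ E) : Prop :=
  ∃ (G : Type u) (_ : NormedAddCommGroup G) (_ : NormedSpace ℝ G) (_ : CompleteSpace G)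
    (A : G →L[ℝ] E), (A : G →ₗ[ℝ] E).range = R

/-- `R` is a proper dense operator range in `E`. -/
structure IsProperDenseOperatorRange {E : Type u} [NormedAddCommGroup E] [NormedSpace ℝ E]
    (R : Submodule ℝ E) : Prop where
  isOperatorRange : IsOperatorRange R
  dense : Dense (R : Set E)
  ne_top : R ≠ ⊤

/-! E₁ is the common kernel of functionals f_n vanishing on L, built together with biorthogonal
vectors x_n. Write R = A(G), and let the sequence (g_i) in the annihilator of L separate the points
outside L from 0. Three estimates suffice. If f_n ∘ A is within 2⁻ⁿ of g_{i(n)} ∘ A, each i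
recurring infinitely often, then every g_i kills R ∩ E₁, which therefore lies in R ∩ L = 0. If ‖x_n‖
‖f_n ∘ A‖ ≤ 2⁻ⁿ, then r - Σ f_n(r) x_n lies in E₁ for r in R, so E₁ + span{x_n} is dense and E/E₁ is
separable; biorthogonality makes it infinite-dimensional. If each T x_m is a limit of points of
T(E₁), the same density gives (d).

The induction carries a finite-dimensional span P of functionals and a finite-dimensional M on which
all later functionals vanish. Two facts leave room for each choice. Since R is proper, dense and
meets L trivially, the adjoint of A is not bounded below on the annihilator of L + S for
finite-dimensional S (`exists_norm_comp_lt`). By the Kato property, the range of T* plus a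
finite-dimensional P never contains the annihilator of L (`HasKatoPropertyFor.not_annih_le`), so P
can be kept transversal to that range; then T maps the kernel of P densely into T(E)
(`MeetsAdjointRangeTrivially.exists_near`). -/

open Filter Topology Pointwise

/-! ### Annihilators, and their duality in finite dimension. -/

section Annihilators

variable {E : Type*} [NormedAddCommGroup E] [NormedSpace ℝ E]

/-- The continuous functionals vanishing on `M`. -/
def annih (M : Submodule ℝ E) : Submodule ℝ (StrongDual ℝ E) where
  carrier := {f | ∀ x ∈ M, f x = 0}
  add_mem' := fun hf hg x hx => by simp [hf x hx, hg x hx]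
  zero_mem' := fun x _ => by simp
  smul_mem' := fun c f hf x hx => by simp [hf x hx]

/-- The common kernel of the functionals in `P`. -/
def coann (P : Submodule ℝ (StrongDual ℝ E)) : Submodule ℝ E where
  carrier := {x | ∀ f ∈ P, f x = 0}
  add_mem' := fun hx hy f hf => by simp [hx f hf, hy f hf]
  zero_mem' := fun f _ => by simp
  smul_mem' := fun c x hx f hf => by simp [hx f hf]

theorem mem_annih {M : Submodule ℝ E} {f : StrongDual ℝ E} :
    f ∈ annih M ↔ ∀ x ∈ M, f x = 0 := Iff.rfl

theorem mem_coann {P : Submodule ℝ (StrongDual ℝ E)} {x : E} :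
    x ∈ coann P ↔ ∀ f ∈ P, f x = 0 := Iff.rfl

theorem annih_anti {M N : Submodule ℝ E} (h : M ≤ N) : annih N ≤ annih M :=
  fun _ hf x hx => hf x (h hx)

theorem mem_annih_sup {M N : Submodule ℝ E} {f : StrongDual ℝ E} :
    f ∈ annih (M ⊔ N) ↔ f ∈ annih M ∧ f ∈ annih N := by
  constructor
  · exact fun h => ⟨annih_anti le_sup_left h, annih_anti le_sup_right h⟩
  · rintro ⟨h1, h2⟩ x hx
    obtain ⟨y, hy, z, hz, rfl⟩ := Submodule.mem_sup.1 hx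
    simp [h1 y hy, h2 z hz]

theorem isClosed_annih (M : Submodule ℝ E) : IsClosed (annih M : Set (StrongDual ℝ E)) := by
  have : (annih M : Set (StrongDual ℝ E)) = ⋂ x ∈ M, {f | f x = 0} := by
    ext f; simp [mem_annih]
  rw [this]
  refine isClosed_biInter fun x _ => isClosed_eq ?_ continuous_const
  exact (ContinuousLinearMap.apply ℝ ℝ x).continuous

theorem isClosed_coann (P : Submodule ℝ (StrongDual ℝ E)) : IsClosed (coann P : Set E) := by
  have : (coann P : Set E) = ⋂ f ∈ P, {x | f x = 0} := by
    ext f; simp [mem_coann]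
  rw [this]
  exact isClosed_biInter fun f _ => isClosed_eq f.continuous continuous_const

theorem le_coann {L : Submodule ℝ E} {P : Submodule ℝ (StrongDual ℝ E)} (h : P ≤ annih L) :
    L ≤ coann P := fun x hx _ hf => h hf x hx

theorem finiteDimensional_quotient_coann (P : Submodule ℝ (StrongDual ℝ E))
    [FiniteDimensional ℝ P] : FiniteDimensional ℝ (E ⧸ coann P) := by
  obtain ⟨s, hs⟩ := Module.Finite.iff_fg.1 (inferInstance : FiniteDimensional ℝ P)
  let ev : E →ₗ[ℝ] (s → ℝ) := LinearMap.pi fun i => ((i : StrongDual ℝ E) : E →ₗ[ℝ] ℝ)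
  have hker : coann P = LinearMap.ker ev := by
    ext x
    rw [mem_coann, LinearMap.mem_ker]
    constructor
    · intro h
      ext i
      exact h i.1 (hs ▸ Submodule.subset_span i.2)
    · intro h g hg
      rw [← hs] at hg
      induction hg using Submodule.span_induction with
      | mem g hg => exact congr_fun h ⟨g, hg⟩
      | zero => simp
      | add g₁ g₂ _ _ h₁ h₂ => simp [h₁, h₂]
      | smul c g _ h => simp [h]
  rw [hker]
  exact Module.Finite.equiv ev.quotKerEquivRange.symm

theorem annih_coann_le (P : Submodule ℝ (StrongDual ℝ E)) [FiniteDimensional ℝ P] :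
    annih (coann P) ≤ P := by
  intro f hf
  obtain ⟨s, hs⟩ := Module.Finite.iff_fg.1 (inferInstance : FiniteDimensional ℝ P)
  have h := mem_span_of_iInf_ker_le_ker
    (L := fun i : s => ((i : StrongDual ℝ E) : E →ₗ[ℝ] ℝ)) (K := (f : E →ₗ[ℝ] ℝ)) (by
      intro x hx
      rw [Submodule.mem_iInf] at hx
      refine hf x fun g hg => ?_
      rw [← hs] at hg
      induction hg using Submodule.span_induction with
      | mem g hg => exact hx ⟨g, hg⟩
      | zero => simp
      | add g₁ g₂ _ _ h₁ h₂ => simp [h₁, h₂]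
      | smul c g _ h => simp [h])
  obtain ⟨c, hc⟩ := (Submodule.mem_span_range_iff_exists_fun ℝ).1 h
  have : f = ∑ i, c i • (i : StrongDual ℝ E) := by
    ext x
    have := LinearMap.congr_fun hc x
    simp at this
    simp [this]
  rw [this, ← hs]
  exact Submodule.sum_mem _ fun i _ => Submodule.smul_mem _ _ (Submodule.subset_span i.2)

/-- A subspace with finite-dimensional quotient has a finite-dimensional complement. -/
theorem exists_isCompl_finiteDimensional {V : Type*} [AddCommGroup V] [Module ℝ V]
    (N : Submodule ℝ V) [FiniteDimensional ℝ (V ⧸ N)] :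
    ∃ S : Submodule ℝ V, IsCompl N S ∧ FiniteDimensional ℝ S := by
  obtain ⟨S, hS⟩ := N.exists_isCompl
  exact ⟨S, hS, Module.Finite.equiv (Submodule.quotientEquivOfIsCompl N S hS)⟩

/-- Small multiples of any n in N can be added to x₀ without leaving U. This turns each mere
existence statement into one valid in every open set meeting N. -/
theorem le_of_isOpen_of_sub_mem {N V : Submodule ℝ E} {U : Set E} (hU : IsOpen U)
    {x₀ : E} (hx₀ : x₀ ∈ U) (hx₀N : x₀ ∈ N) (h : ∀ x ∈ U, x ∈ N → x - x₀ ∈ V) : N ≤ V := by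
  intro n hn
  have hc : Tendsto (fun t : ℝ => x₀ + t • n) (𝓝[≠] 0) (𝓝 x₀) := by
    have : Continuous fun t : ℝ => x₀ + t • n := by fun_prop
    simpa using (this.tendsto 0).mono_left (nhdsWithin_le_nhds (s := {0}ᶜ))
  obtain ⟨t, htU, ht⟩ := ((hc.eventually (hU.mem_nhds hx₀)).and self_mem_nhdsWithin).exists
  have h1 := h _ htU (N.add_mem hx₀N (N.smul_mem t hn))
  rw [add_sub_cancel_left] at h1
  exact (V.smul_mem_iff ht).1 h1

end Annihilators

/-! ### Adjoints bounded below modulo a subspace, and codimension of operator ranges. -/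

section Surjectivity

variable {E G : Type*} [NormedAddCommGroup E] [NormedSpace ℝ E] [NormedAddCommGroup G]
  [NormedSpace ℝ G]

/-- Otherwise Hahn–Banach separates z from A(rB) + M, where B is the closed unit ball. The
separating f kills M and has ‖f ∘ A‖ ≤ u / r, so f z ≤ C / (C + 1) * u ≤ u, a contradiction. The
constant C + 1 keeps r positive when C = 0. -/
theorem exists_approx_of_adjoint_bounded_below (A : G →L[ℝ] E) (M : Submodule ℝ E) {C : ℝ}
    (hC : 0 ≤ C) (h : ∀ f ∈ annih M, ‖f‖ ≤ C * ‖f.comp A‖) (z : E) :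
    ∃ g : G, ∃ m ∈ M, ‖z - A g - m‖ ≤ ‖z‖ / 2 ∧ ‖g‖ ≤ (C + 1) * ‖z‖ := by
  rcases eq_or_ne z 0 with rfl | hz
  · exact ⟨0, 0, M.zero_mem, by simp⟩
  have hz' : 0 < ‖z‖ := norm_pos_iff.2 hz
  set r := (C + 1) * ‖z‖ with hr
  have hr0 : 0 < r := by positivity
  let s : Set E := A '' Metric.closedBall 0 r + (M : Set E)
  have hs : Convex ℝ s :=
    ((convex_closedBall (0 : G) r).linear_image (A : G →ₗ[ℝ] E)).add M.convex
  have hzs : z ∈ closure s := by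
    by_contra hzs
    obtain ⟨f, u, hfu, huz⟩ := geometric_hahn_banach_closed_point hs.closure isClosed_closure hzs
    have hval : ∀ g : G, ‖g‖ ≤ r → ∀ m ∈ M, f (A g) + f m < u := by
      intro g hg m hm
      rw [← map_add]
      exact hfu _ (subset_closure (Set.add_mem_add ⟨g, by simpa using hg, rfl⟩ hm))
    have hu0 : 0 < u := by simpa using hval 0 (by simpa using hr0.le) 0 M.zero_mem
    have hfM : f ∈ annih M := by
      intro m hm
      by_contra hne
      have := hval 0 (by simpa using hr0.le) ((u / f m) • m) (M.smul_mem _ hm)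
      simp [hne] at this
    have hball : ∀ g : G, f (A g) ≤ u / r * ‖g‖ := by
      intro g
      rcases eq_or_ne g 0 with rfl | hg
      · simp
      have hg' : 0 < ‖g‖ := norm_pos_iff.2 hg
      have h1 := hval ((r / ‖g‖) • g) (by
        rw [norm_smul, Real.norm_of_nonneg (by positivity), div_mul_cancel₀ _ hg'.ne'])
        0 M.zero_mem
      simp only [map_smul, map_zero, add_zero, smul_eq_mul] at h1
      rw [div_mul_eq_mul_div, div_lt_iff₀ hg'] at h1
      rw [div_mul_eq_mul_div, le_div_iff₀ hr0]
      linarith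
    have hnorm : ‖f.comp A‖ ≤ u / r := by
      refine ContinuousLinearMap.opNorm_le_bound _ (by positivity) fun g => ?_
      rw [ContinuousLinearMap.comp_apply, Real.norm_eq_abs, abs_le]
      have h2 := hball (-g)
      simp only [map_neg, norm_neg] at h2
      exact ⟨by linarith, hball g⟩
    have h3 : f z ≤ C * (u / r) * ‖z‖ :=
      (le_abs_self _).trans ((f.le_opNorm z).trans
        (mul_le_mul_of_nonneg_right ((h f hfM).trans (mul_le_mul_of_nonneg_left hnorm hC))
          hz'.le))
    have h4 : C * (u / r) * ‖z‖ = C / (C + 1) * u := by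
      rw [hr]; field_simp
    have h5 : C / (C + 1) * u ≤ u := by
      refine mul_le_of_le_one_left hu0.le ?_
      rw [div_le_one (by positivity)]; linarith
    linarith
  obtain ⟨w, ⟨_, ⟨g, hg, rfl⟩, m, hm, rfl⟩, hw⟩ :=
    Metric.mem_closure_iff.1 hzs (‖z‖ / 2) (by positivity)
  refine ⟨g, m, hm, ?_, by simpa using hg⟩
  rw [dist_eq_norm] at hw
  simpa [sub_sub] using hw.le

/-- Successive approximation: the residual halves at each step, the corrections in G sum by
completeness, and the part in M converges because M is closed. -/
theorem range_sup_eq_top_of_adjoint_bounded_below [CompleteSpace G] (A : G →L[ℝ] E)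
    (M : Submodule ℝ E)
    (hM : IsClosed (M : Set E)) {C : ℝ} (hC : 0 ≤ C)
    (h : ∀ f ∈ annih M, ‖f‖ ≤ C * ‖f.comp A‖) : (A : G →ₗ[ℝ] E).range ⊔ M = ⊤ := by
  choose γ μ hμ hres hγ using exists_approx_of_adjoint_bounded_below A M hC h
  rw [eq_top_iff]
  rintro z -
  let r : ℕ → E := fun n => Nat.rec z (fun _ w => w - A (γ w) - μ w) n
  have hr : ∀ n, r (n + 1) = r n - A (γ (r n)) - μ (r n) := fun n => rfl
  have hrn : ∀ n, ‖r n‖ ≤ ‖z‖ * (1 / 2) ^ n := by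
    intro n
    induction n with
    | zero => simp [r]
    | succ n ih =>
      rw [hr, pow_succ]
      have := hres (r n)
      linarith
  have hsum : Summable fun n => γ (r n) := by
    refine Summable.of_norm_bounded (g := fun n => (C + 1) * (‖z‖ * (1 / 2) ^ n))
      ((summable_geometric_two.mul_left _).mul_left _) fun n => ?_
    exact (hγ _).trans (mul_le_mul_of_nonneg_left (hrn n) (by positivity))
  have hpart : ∀ n, ∑ i ∈ Finset.range n, μ (r i) =
      z - r n - A (∑ i ∈ Finset.range n, γ (r i)) := by
    intro n
    induction n with
    | zero => simp [r]
    | succ n ih =>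
      rw [Finset.sum_range_succ, ih, Finset.sum_range_succ, hr, map_add]
      abel
  have hr0 : Tendsto r atTop (𝓝 0) := by
    refine squeeze_zero_norm hrn ?_
    simpa using (tendsto_pow_atTop_nhds_zero_of_lt_one (by norm_num : (0 : ℝ) ≤ 1 / 2)
      (by norm_num)).const_mul ‖z‖
  have hlim : Tendsto (fun n => ∑ i ∈ Finset.range n, μ (r i)) atTop
      (𝓝 (z - 0 - A (∑' n, γ (r n)))) := by
    simp_rw [hpart]
    exact (tendsto_const_nhds.sub hr0).sub
      ((A.continuous.tendsto _).comp hsum.hasSum.tendsto_sum_nat)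
  have hmem := hM.mem_of_tendsto hlim
    (Eventually.of_forall fun n => M.sum_mem fun i _ => hμ _)
  rw [sub_zero] at hmem
  exact Submodule.mem_sup.2 ⟨_, ⟨∑' n, γ (r n), rfl⟩, _, hmem, by simp⟩

/-- A dense proper operator range `R` meeting the closed subspace `L` trivially cannot have
`R + L` of finite codimension. -/
theorem range_sup_sup_ne_top [CompleteSpace E] [CompleteSpace G] (A : G →L[ℝ] E)
    (L S : Submodule ℝ E) (hL : IsClosed (L : Set E)) [FiniteDimensional ℝ S]
    (hdense : Dense ((A : G →ₗ[ℝ] E).range : Set E)) (hne : (A : G →ₗ[ℝ] E).range ≠ ⊤)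
    (hdisj : (A : G →ₗ[ℝ] E).range ⊓ L = ⊥) : (A : G →ₗ[ℝ] E).range ⊔ (L ⊔ S) ≠ ⊤ := by
  intro htop
  set R := (A : G →ₗ[ℝ] E).range with hR
  have hfin : FiniteDimensional ℝ (E ⧸ (R ⊔ L)) := by
    refine Module.Finite.of_surjective ((R ⊔ L).mkQ.comp S.subtype) ?_
    intro q
    obtain ⟨x, rfl⟩ := Submodule.mkQ_surjective _ q
    have hx : x ∈ (R ⊔ L) ⊔ S := by rw [sup_assoc, htop]; trivial
    obtain ⟨y, hy, z, hz, rfl⟩ := Submodule.mem_sup.1 hx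
    refine ⟨⟨z, hz⟩, ?_⟩
    simp only [LinearMap.comp_apply, Submodule.subtype_apply, map_add]
    rw [show (R ⊔ L).mkQ y = 0 from (Submodule.Quotient.mk_eq_zero _).2 hy, zero_add]
  -- S may meet R ⊔ L; a complement S' makes R ⊔ (L ⊔ S') a direct sum.
  obtain ⟨S', hS', hS'fin⟩ := exists_isCompl_finiteDimensional (R ⊔ L)
  set M := L ⊔ S' with hM
  have hMclosed : IsClosed (M : Set E) := Submodule.isClosed_sup_finiteDimensional _ _ hL
  have hRM : Disjoint R M :=
    Disjoint.disjoint_sup_right_of_disjoint_sup_left (disjoint_iff.2 hdisj) hS'.disjoint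
  have hRMtop : R ⊔ M = ⊤ := by rw [hM, ← sup_assoc]; exact hS'.codisjoint.eq_top
  have : CompleteSpace M := hMclosed.completeSpace_coe
  let Φ : G × M →L[ℝ] E := A.coprod M.subtypeL
  have hΦ : Function.Surjective Φ := by
    intro x
    have hx : x ∈ R ⊔ M := by rw [hRMtop]; trivial
    obtain ⟨_, ⟨g, rfl⟩, m, hm, rfl⟩ := Submodule.mem_sup.1 hx
    exact ⟨(g, ⟨m, hm⟩), by simp [Φ]⟩
  -- Directness identifies the preimage of R with the closed set m = 0. As Φ is a quotient map by
  -- the open mapping theorem, R is closed, hence everything.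
  have hpre : Φ ⁻¹' (R : Set E) = {p | p.2 = 0} := by
    ext ⟨g, m⟩
    have hg : A g ∈ R := ⟨g, rfl⟩
    simp only [Set.mem_preimage, SetLike.mem_coe, Set.mem_ofPred_eq]
    have : Φ (g, m) = A g + m := by simp [Φ]
    rw [this, Submodule.add_mem_iff_right _ hg]
    constructor
    · intro hm
      exact Subtype.ext (Submodule.disjoint_def.1 hRM _ hm m.2)
    · rintro rfl; simp
  have hRclosed : IsClosed (R : Set E) := by
    rw [← (Φ.isQuotientMap hΦ).isClosed_preimage, hpre]
    exact isClosed_eq continuous_snd continuous_const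
  apply hne
  rw [← SetLike.coe_set_eq, Submodule.top_coe, ← hRclosed.closure_eq]
  exact hdense.closure_eq

theorem exists_norm_comp_lt [CompleteSpace E] [CompleteSpace G] (A : G →L[ℝ] E)
    (L : Submodule ℝ E) (hL : IsClosed (L : Set E))
    (hdense : Dense ((A : G →ₗ[ℝ] E).range : Set E)) (hne : (A : G →ₗ[ℝ] E).range ≠ ⊤)
    (hdisj : (A : G →ₗ[ℝ] E).range ⊓ L = ⊥) (S : Submodule ℝ E) [FiniteDimensional ℝ S] (C : ℝ) :
    ∃ h ∈ annih (L ⊔ S), C * ‖h.comp A‖ < ‖h‖ := by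
  by_contra! hcon
  refine range_sup_sup_ne_top A L S hL hdense hne hdisj
    (range_sup_eq_top_of_adjoint_bounded_below A (L ⊔ S)
      (Submodule.isClosed_sup_finiteDimensional _ _ hL) (abs_nonneg C) fun f hf => ?_)
  exact (hcon f hf).trans (mul_le_mul_of_nonneg_right (le_abs_self C) (norm_nonneg _))

end Surjectivity

/-! ### Prescribing functionals on finite-dimensional spaces at small cost along A. -/

section Separation

variable {E G : Type*} [NormedAddCommGroup E] [NormedSpace ℝ E] [NormedAddCommGroup G]
  [NormedSpace ℝ G]

/-- Functionals in `annih L` can be prescribed on `M` with arbitrarily small composition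
with `A`. -/
def IsFreeFor (A : G →L[ℝ] E) (L M : Submodule ℝ E) : Prop :=
  ∀ g ∈ annih L, ∀ ε : ℝ, 0 < ε → ∃ h ∈ annih L, (∀ x ∈ M, h x = g x) ∧ ‖h.comp A‖ < ε

/-- The vector `u` is normed to `1` by functionals vanishing on `L` and `M` whose composition
with `A` is arbitrarily small. -/
def IsSeparatedFrom (A : G →L[ℝ] E) (L M : Submodule ℝ E) (u : E) : Prop :=
  ∀ ε : ℝ, 0 < ε → ∃ h ∈ annih (L ⊔ M), h u = 1 ∧ ‖h.comp A‖ < ε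

theorem isFreeFor_bot (A : G →L[ℝ] E) (L : Submodule ℝ E) : IsFreeFor A L ⊥ :=
  fun g _ ε hε => ⟨0, Submodule.zero_mem _, by simp, by simpa using hε⟩

theorem IsFreeFor.sup_span {A : G →L[ℝ] E} {L M : Submodule ℝ E} {u : E}
    (hM : IsFreeFor A L M) (hu : IsSeparatedFrom A L M u) :
    IsFreeFor A L (M ⊔ Submodule.span ℝ {u}) := by
  intro g hg ε hε
  obtain ⟨h, hL, hgh, hA⟩ := hM g hg (ε / 2) (by positivity)
  set t := g u - h u
  obtain ⟨k, hk, hku, hkA⟩ := hu (ε / (2 * (|t| + 1))) (by positivity)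
  rw [mem_annih_sup] at hk
  refine ⟨h + t • k, Submodule.add_mem _ hL (Submodule.smul_mem _ _ hk.1), ?_, ?_⟩
  · intro x hx
    obtain ⟨y, hy, z, hz, rfl⟩ := Submodule.mem_sup.1 hx
    obtain ⟨c, rfl⟩ := Submodule.mem_span_singleton.1 hz
    simp [hgh y hy, hk.2 y hy, hku, t]
    ring
  · have h1 : (h + t • k).comp A = h.comp A + t • k.comp A := by ext; simp
    have h2 : |t| * ‖k.comp A‖ ≤ ε / 2 := by
      calc |t| * ‖k.comp A‖ ≤ (|t| + 1) * (ε / (2 * (|t| + 1))) := by gcongr; linarith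
        _ = ε / 2 := by field_simp
    calc ‖(h + t • k).comp A‖ ≤ ‖h.comp A‖ + ‖t • k.comp A‖ := by rw [h1]; exact norm_add_le _ _
      _ = ‖h.comp A‖ + |t| * ‖k.comp A‖ := by rw [norm_smul, Real.norm_eq_abs]
      _ < ε := by linarith

theorem IsSeparatedFrom.smul {A : G →L[ℝ] E} {L M : Submodule ℝ E} {u : E}
    (hu : IsSeparatedFrom A L M u) {c : ℝ} (hc : c ≠ 0) : IsSeparatedFrom A L M (c • u) := by
  intro ε hε
  obtain ⟨h, hh, hhu, hA⟩ := hu (ε * |c|) (by positivity)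
  refine ⟨c⁻¹ • h, Submodule.smul_mem _ _ hh, by simp [hhu, hc], ?_⟩
  have : (c⁻¹ • h).comp A = c⁻¹ • h.comp A := by ext; simp
  rw [this, norm_smul, norm_inv, Real.norm_eq_abs, inv_mul_lt_iff₀ (abs_pos.2 hc)]
  linarith

/-- The vectors on which the functionals vanishing on `M` are controlled by their composition
with `A`. -/
def controlled (A : G →L[ℝ] E) (M : Submodule ℝ E) : Submodule ℝ E where
  carrier := {u | ∃ C : ℝ, ∀ h ∈ annih M, |h u| ≤ C * ‖h.comp A‖}
  add_mem' := by
    rintro u v ⟨C, hC⟩ ⟨D, hD⟩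
    refine ⟨C + D, fun h hh => ?_⟩
    rw [map_add, add_mul]
    exact (abs_add_le _ _).trans (add_le_add (hC h hh) (hD h hh))
  zero_mem' := ⟨0, by simp⟩
  smul_mem' := by
    rintro c u ⟨C, hC⟩
    refine ⟨|c| * C, fun h hh => ?_⟩
    rw [map_smul, smul_eq_mul, abs_mul, mul_assoc]
    exact mul_le_mul_of_nonneg_left (hC h hh) (abs_nonneg c)

theorem mem_controlled_of_not_isSeparatedFrom {A : G →L[ℝ] E} {L M : Submodule ℝ E} {u : E}
    (hu : ¬ IsSeparatedFrom A L M u) : u ∈ controlled A (L ⊔ M) := by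
  unfold IsSeparatedFrom at hu
  push Not at hu
  obtain ⟨ε, hε, hu⟩ := hu
  refine ⟨1 / ε, fun h hh => ?_⟩
  rcases eq_or_ne (h u) 0 with h0 | h0
  · rw [h0, abs_zero]; positivity
  have h1 := hu ((h u)⁻¹ • h) (Submodule.smul_mem _ _ hh) (by simp [h0])
  have h2 : ((h u)⁻¹ • h).comp A = (h u)⁻¹ • h.comp A := by ext; simp
  rw [h2, norm_smul, norm_inv, Real.norm_eq_abs, le_inv_mul_iff₀ (abs_pos.2 h0)] at h1
  rw [div_mul_eq_mul_div, one_mul, le_div_iff₀ hε]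
  exact h1

variable [CompleteSpace E]

/-- Functionals that also vanish on a complement of N and satisfy ‖h ∘ A‖ ≤ 1 would be pointwise
bounded, hence uniformly bounded by Banach–Steinhaus, against `hA`. -/
theorem not_le_controlled {A : G →L[ℝ] E} {L : Submodule ℝ E}
    (hA : ∀ S : Submodule ℝ E, FiniteDimensional ℝ S → ∀ C : ℝ,
      ∃ h ∈ annih (L ⊔ S), C * ‖h.comp A‖ < ‖h‖)
    (M N : Submodule ℝ E) [FiniteDimensional ℝ M] [FiniteDimensional ℝ (E ⧸ N)] :
    ¬ N ≤ controlled A (L ⊔ M) := by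
  intro hN
  obtain ⟨S, hS, hSfin⟩ := exists_isCompl_finiteDimensional N
  have hpt : ∀ x : E, ∃ C, ∀ i : {h : StrongDual ℝ E // h ∈ annih (L ⊔ (M ⊔ S)) ∧
      ‖h.comp A‖ ≤ 1}, ‖i.1 x‖ ≤ C := by
    intro x
    have hx : x ∈ N ⊔ S := by rw [hS.codisjoint.eq_top]; trivial
    obtain ⟨n, hn, s, hs, rfl⟩ := Submodule.mem_sup.1 hx
    obtain ⟨C, hC⟩ := hN hn
    refine ⟨|C|, fun ⟨h, hh, hhA⟩ => ?_⟩
    rw [← sup_assoc, mem_annih_sup] at hh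
    rw [map_add, hh.2 s hs, add_zero, Real.norm_eq_abs]
    calc |h n| ≤ C * ‖h.comp A‖ := hC h hh.1
      _ ≤ |C| * 1 := by gcongr; exact le_abs_self C
      _ = |C| := mul_one _
  obtain ⟨C, hC⟩ := banach_steinhaus hpt
  obtain ⟨h, hh, hlt⟩ := hA (M ⊔ S) inferInstance (|C| + 1)
  have hpos : 0 < ‖h‖ := lt_of_le_of_lt (by positivity) hlt
  have key : ∀ t : ℝ, 0 < t → t * ‖h.comp A‖ ≤ 1 → t * ‖h‖ ≤ |C| := by
    intro t ht hta
    have h2 : (t • h).comp A = t • h.comp A := by ext; simp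
    have h3 := hC ⟨t • h, Submodule.smul_mem _ _ hh, by
      rw [h2, norm_smul, Real.norm_of_nonneg ht.le]; exact hta⟩
    rw [norm_smul, Real.norm_of_nonneg ht.le] at h3
    exact h3.trans (le_abs_self C)
  have h1 := key ((|C| + 1) / ‖h‖) (by positivity) (by
    rw [div_mul_eq_mul_div, div_le_one hpos]; exact hlt.le)
  rw [div_mul_cancel₀ _ hpos.ne'] at h1
  linarith

/-- Non-separated vectors lie in the subspace `controlled A (L ⊔ M)`, which cannot contain a
relatively open piece of N. -/
theorem exists_isSeparatedFrom {A : G →L[ℝ] E} {L : Submodule ℝ E}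
    (hA : ∀ S : Submodule ℝ E, FiniteDimensional ℝ S → ∀ C : ℝ,
      ∃ h ∈ annih (L ⊔ S), C * ‖h.comp A‖ < ‖h‖)
    (M N : Submodule ℝ E) [FiniteDimensional ℝ M] [FiniteDimensional ℝ (E ⧸ N)]
    {U : Set E} (hU : IsOpen U) {x₀ : E} (hx₀ : x₀ ∈ U) (hx₀N : x₀ ∈ N) :
    ∃ u ∈ U, u ∈ N ∧ IsSeparatedFrom A L M u := by
  by_contra! hcon
  have hmem : ∀ u ∈ U, u ∈ N → u ∈ controlled A (L ⊔ M) := fun u hu huN =>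
    mem_controlled_of_not_isSeparatedFrom (hcon u hu huN)
  exact not_le_controlled hA M N (le_of_isOpen_of_sub_mem hU hx₀ hx₀N fun x hx hxN =>
    Submodule.sub_mem _ (hmem x hx hxN) (hmem x₀ hx₀ hx₀N))

end Separation

/-! ### The Kato property as a statement about the range of the adjoint. -/

section Kato

variable {E : Type u} {F : Type v} [NormedAddCommGroup E] [NormedSpace ℝ E]
  [NormedAddCommGroup F] [NormedSpace ℝ F]

/-- The sum of the range of the adjoint of `T` and `P`. -/
def adjointRangeSup (T : E →L[ℝ] F) (P : Submodule ℝ (StrongDual ℝ E)) :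
    Submodule ℝ (StrongDual ℝ E) where
  carrier := {f | ∃ φ : StrongDual ℝ F, f - φ.comp T ∈ P}
  add_mem' := by
    rintro f g ⟨φ, hφ⟩ ⟨ψ, hψ⟩
    refine ⟨φ + ψ, ?_⟩
    rw [ContinuousLinearMap.add_comp, add_sub_add_comm]
    exact P.add_mem hφ hψ
  zero_mem' := ⟨0, by simp⟩
  smul_mem' := by
    rintro c f ⟨φ, hφ⟩
    refine ⟨c • φ, ?_⟩
    rw [ContinuousLinearMap.smul_comp, ← smul_sub]
    exact P.smul_mem c hφ

theorem norm_mkQ_le_of_forall_annih {L : Submodule ℝ E} (hL : IsClosed (L : Set E)) {x : E}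
    {C : ℝ} (h : ∀ f ∈ annih L, |f x| ≤ C * ‖f‖) (hC : 0 ≤ C) : ‖L.mkQ x‖ ≤ C := by
  have : IsClosed (L : Set E) := hL
  obtain ⟨φ, hφ, hφx⟩ := exists_dual_vector'' ℝ (L.mkQ x)
  let q : E →L[ℝ] E ⧸ L := L.mkQL
  have hq : ∀ y, ‖q y‖ ≤ 1 * ‖y‖ := fun y => by
    rw [one_mul]; exact Submodule.Quotient.norm_mk_le L y
  have h1 := h (φ.comp q) (fun y hy => by
    have : q y = 0 := (Submodule.Quotient.mk_eq_zero _).2 hy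
    simp [this])
  have h2 : ‖φ.comp q‖ ≤ 1 := by
    refine (ContinuousLinearMap.opNorm_comp_le _ _).trans ?_
    exact mul_le_one₀ hφ (norm_nonneg _) (ContinuousLinearMap.opNorm_le_bound _ zero_le_one hq)
  have h3 : (φ.comp q) x = ‖L.mkQ x‖ := by simpa [q] using hφx
  rw [h3, abs_of_nonneg (norm_nonneg _)] at h1
  exact h1.trans (mul_le_of_le_one_right hC h2)

theorem exists_bound_on_closed_submodule {V ι : Type*} [NormedAddCommGroup V] [NormedSpace ℝ V]
    [CompleteSpace V] {H : Submodule ℝ V} (hH : IsClosed (H : Set V)) {g : ι → StrongDual ℝ V}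
    (h : ∀ x ∈ H, ∃ C, ∀ i, ‖g i x‖ ≤ C) : ∃ C, ∀ i, ∀ x ∈ H, ‖g i x‖ ≤ C * ‖x‖ := by
  have : CompleteSpace H := hH.completeSpace_coe
  obtain ⟨C, hC⟩ := banach_steinhaus (g := fun i => (g i).comp H.subtypeL)
    (fun x => h x.1 x.2)
  exact ⟨C, fun i x hx => (((g i).comp H.subtypeL).le_opNorm ⟨x, hx⟩).trans
    (mul_le_mul_of_nonneg_right (hC i) (norm_nonneg _))⟩

/-- If f - φ ∘ T lies in P, then |f| ≤ ‖φ‖ on the x in `coann P` with ‖T x‖ ≤ 1. Banach–Steinhaus on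
the annihilator of L would bound ‖Q_L x‖ over all such x, which the Kato property on `coann P`
forbids. -/
theorem HasKatoPropertyFor.not_annih_le {T : E →L[ℝ] F} {L : Submodule ℝ E}
    (hT : HasKatoPropertyFor T L) (hL : IsClosed (L : Set E)) (P : Submodule ℝ (StrongDual ℝ E))
    [FiniteDimensional ℝ P] (hP : P ≤ annih L) : ¬ annih L ≤ adjointRangeSup T P := by
  intro hle
  have hcl : IsClosed (annih L : Set (StrongDual ℝ E)) := isClosed_annih L
  have hpt : ∀ f ∈ annih L, ∃ C, ∀ x : {x : E // x ∈ coann P ∧ ‖T x‖ ≤ 1},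
      ‖ContinuousLinearMap.apply ℝ ℝ x.1 f‖ ≤ C := by
    intro f hf
    obtain ⟨φ, hφ⟩ := hle hf
    refine ⟨‖φ‖, fun x => ?_⟩
    have h1 : f x.1 = φ (T x.1) := by
      have := x.2.1 _ hφ
      simpa [sub_eq_zero] using this
    change ‖f x.1‖ ≤ _
    rw [h1]
    exact (φ.le_opNorm _).trans (mul_le_of_le_one_right (norm_nonneg _) x.2.2)
  obtain ⟨C, hC⟩ := exists_bound_on_closed_submodule hcl hpt
  have hbd : ∀ x ∈ coann P, ‖T x‖ ≤ 1 → ‖L.mkQ x‖ ≤ |C| := by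
    intro x hx hTx
    refine norm_mkQ_le_of_forall_annih hL (fun f hf => ?_) (abs_nonneg C)
    exact (hC ⟨x, hx, hTx⟩ f hf).trans
      (mul_le_mul_of_nonneg_right (le_abs_self C) (norm_nonneg _))
  obtain ⟨x, hx, hxL, hTx⟩ := hT (coann P) (isClosed_coann P)
    (finiteDimensional_quotient_coann P) (le_coann hP) (1 / (|C| + 1)) (by positivity)
  have : IsClosed (L : Set E) := hL
  have hpos : 0 < ‖L.mkQ x‖ :=
    norm_pos_iff.2 fun h0 => hxL ((Submodule.Quotient.mk_eq_zero _).1 h0)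
  set t := (|C| + 1) / ‖L.mkQ x‖ with ht
  have ht0 : 0 < t := by positivity
  have h1 := hbd (t • x) (Submodule.smul_mem _ _ hx) (by
    rw [map_smul, norm_smul, Real.norm_of_nonneg ht0.le]
    calc t * ‖T x‖ ≤ t * (1 / (|C| + 1) * ‖L.mkQ x‖) := by gcongr
      _ = 1 := by rw [ht]; field_simp)
  rw [map_smul, norm_smul, Real.norm_of_nonneg ht0.le, ht, div_mul_cancel₀ _ hpos.ne'] at h1
  linarith

theorem exists_finiteDimensional_le_inf_ker_sup {V W : Type*} [AddCommGroup V] [Module ℝ V]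
    [AddCommGroup W] [Module ℝ W] [FiniteDimensional ℝ W] (H : Submodule ℝ V) (ev : V →ₗ[ℝ] W) :
    ∃ S : Submodule ℝ V, FiniteDimensional ℝ S ∧ S ≤ H ∧ H ≤ (H ⊓ LinearMap.ker ev) ⊔ S := by
  have hfin : FiniteDimensional ℝ (H ⧸ LinearMap.ker (ev.domRestrict H)) :=
    Module.Finite.equiv (ev.domRestrict H).quotKerEquivRange.symm
  obtain ⟨S, hS, hSfin⟩ := exists_isCompl_finiteDimensional (LinearMap.ker (ev.domRestrict H))
  refine ⟨S.map H.subtype, inferInstance, Submodule.map_subtype_le _ _, ?_⟩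
  intro f hf
  have hx : (⟨f, hf⟩ : H) ∈ LinearMap.ker (ev.domRestrict H) ⊔ S := by
    rw [hS.codisjoint.eq_top]; trivial
  obtain ⟨k, hk, g, hg, hkg⟩ := Submodule.mem_sup.1 hx
  exact Submodule.mem_sup.2 ⟨k, ⟨k.2, hk⟩, g, ⟨g, hg, rfl⟩, congrArg Subtype.val hkg⟩

theorem exists_finiteDimensional_annih_le_sup (L M : Submodule ℝ E) [FiniteDimensional ℝ M] :
    ∃ S : Submodule ℝ (StrongDual ℝ E), FiniteDimensional ℝ S ∧ S ≤ annih L ∧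
      annih L ≤ annih (L ⊔ M) ⊔ S := by
  obtain ⟨s, hs⟩ := Module.Finite.iff_fg.1 (inferInstance : FiniteDimensional ℝ M)
  let ev : StrongDual ℝ E →ₗ[ℝ] (s → ℝ) := LinearMap.pi fun i =>
    ((ContinuousLinearMap.apply ℝ ℝ (i : E)) : StrongDual ℝ E →ₗ[ℝ] ℝ)
  obtain ⟨S, hSfin, hSL, hS⟩ := exists_finiteDimensional_le_inf_ker_sup (annih L) ev
  refine ⟨S, hSfin, hSL, hS.trans (sup_le_sup_right ?_ S)⟩
  rintro k ⟨hkL, hk⟩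
  refine mem_annih_sup.2 ⟨hkL, fun x hx => ?_⟩
  rw [← hs] at hx
  induction hx using Submodule.span_induction with
  | mem x hx => exact congr_fun (LinearMap.mem_ker.1 hk) ⟨x, hx⟩
  | zero => simp
  | add x y _ _ h₁ h₂ => simp [h₁, h₂]
  | smul c x _ h => simp [h]

/-- Vanishing on M costs only finitely many dimensions, which P absorbs. -/
theorem HasKatoPropertyFor.not_annih_sup_le {T : E →L[ℝ] F} {L : Submodule ℝ E}
    (hT : HasKatoPropertyFor T L) (hL : IsClosed (L : Set E)) (P : Submodule ℝ (StrongDual ℝ E))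
    [FiniteDimensional ℝ P] (hP : P ≤ annih L) (M : Submodule ℝ E) [FiniteDimensional ℝ M] :
    ¬ annih (L ⊔ M) ≤ adjointRangeSup T P := by
  intro hle
  obtain ⟨S, hSfin, hSL, hS⟩ := exists_finiteDimensional_annih_le_sup L M
  refine hT.not_annih_le hL (P ⊔ S) (sup_le hP hSL) (hS.trans (sup_le (hle.trans ?_) ?_))
  · rintro f ⟨φ, hφ⟩
    exact ⟨φ, le_sup_left (a := P) hφ⟩
  · intro f hf
    exact ⟨0, by simpa using le_sup_right (a := P) hf⟩

/-- Only the zero functional on the range of `T` induces an element of `P`. -/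
def MeetsAdjointRangeTrivially (T : E →L[ℝ] F) (P : Submodule ℝ (StrongDual ℝ E)) : Prop :=
  ∀ φ : StrongDual ℝ F, φ.comp T ∈ P → φ.comp T = 0

theorem MeetsAdjointRangeTrivially.sup_span {T : E →L[ℝ] F} {P : Submodule ℝ (StrongDual ℝ E)}
    (hP : MeetsAdjointRangeTrivially T P) {f : StrongDual ℝ E} (hf : f ∉ adjointRangeSup T P) :
    MeetsAdjointRangeTrivially T (P ⊔ Submodule.span ℝ {f}) := by
  intro φ hφ
  obtain ⟨p, hp, q, hq, hpq⟩ := Submodule.mem_sup.1 hφ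
  obtain ⟨c, rfl⟩ := Submodule.mem_span_singleton.1 hq
  rcases eq_or_ne c 0 with rfl | hc
  · apply hP
    rw [← hpq]; simpa using hp
  · refine absurd ⟨c⁻¹ • φ, ?_⟩ hf
    rw [ContinuousLinearMap.smul_comp, ← hpq, smul_add, smul_smul, inv_mul_cancel₀ hc, one_smul,
      sub_add_cancel_right]
    exact P.neg_mem (P.smul_mem _ hp)

/-- A functional φ killing T(`coann P`) has φ ∘ T in P, since P is finite-dimensional; so φ ∘ T = 0,
and Hahn–Banach gives density. -/
theorem MeetsAdjointRangeTrivially.exists_near {T : E →L[ℝ] F}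
    {P : Submodule ℝ (StrongDual ℝ E)} [FiniteDimensional ℝ P]
    (hP : MeetsAdjointRangeTrivially T P) (t : E) {ε : ℝ} (hε : 0 < ε) :
    ∃ y ∈ coann P, ‖T (t - y)‖ < ε := by
  have hmem : T t ∈ closure (((coann P).map (T : E →ₗ[ℝ] F) : Submodule ℝ F) : Set F) := by
    by_contra hcon
    set N := (coann P).map (T : E →ₗ[ℝ] F) with hN
    obtain ⟨φ, u, hφu, huz⟩ :=
      geometric_hahn_banach_closed_point N.convex.closure isClosed_closure hcon
    have hu0 : 0 < u := by simpa using hφu 0 (subset_closure N.zero_mem)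
    have hzero : ∀ y ∈ N, φ y = 0 := by
      intro y hy
      by_contra hne
      have := hφu ((u / φ y) • y) (subset_closure (N.smul_mem _ hy))
      simp [hne] at this
    have h1 : φ.comp T ∈ P := annih_coann_le P fun x hx => hzero _ ⟨x, hx, rfl⟩
    have h2 : φ (T t) = 0 := DFunLike.congr_fun (hP φ h1) t
    linarith
  obtain ⟨_, ⟨y, hy, rfl⟩, hlt⟩ := Metric.mem_closure_iff.1 hmem ε hε
  refine ⟨y, hy, ?_⟩
  rw [map_sub]
  simpa [dist_eq_norm] using hlt

end Kato

/-! ### The inductive construction of the biorthogonal system. -/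

section Construction

variable {E : Type u} {F : Type v} {G : Type*} [NormedAddCommGroup E] [NormedSpace ℝ E]
  [CompleteSpace E] [NormedAddCommGroup F] [NormedSpace ℝ F] [NormedAddCommGroup G]
  [NormedSpace ℝ G]

theorem exists_functional_near {A : G →L[ℝ] E} {T : E →L[ℝ] F} {L : Submodule ℝ E}
    (hA : ∀ S : Submodule ℝ E, FiniteDimensional ℝ S → ∀ C : ℝ,
      ∃ h ∈ annih (L ⊔ S), C * ‖h.comp A‖ < ‖h‖)
    (hT : HasKatoPropertyFor T L) (hL : IsClosed (L : Set E))
    {P : Submodule ℝ (StrongDual ℝ E)} [FiniteDimensional ℝ P] (hP : P ≤ annih L)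
    (hPT : MeetsAdjointRangeTrivially T P) {M : Submodule ℝ E} [FiniteDimensional ℝ M]
    (hM : IsFreeFor A L M) {g : StrongDual ℝ E} (hg : g ∈ annih L) {η : ℝ} (hη : 0 < η) (K : ℝ) :
    ∃ f ∈ annih (L ⊔ M), ‖(f - g).comp A‖ < η ∧
      MeetsAdjointRangeTrivially T (P ⊔ Submodule.span ℝ {f}) ∧
      ∃ n ∈ coann P, K * ‖n‖ < |f n| := by
  have := finiteDimensional_quotient_coann P
  obtain ⟨n, -, hnP, hn⟩ := exists_isSeparatedFrom hA M (coann P) isOpen_univ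
    (Set.mem_univ 0) (Submodule.zero_mem _)
  obtain ⟨h₀, hh₀, hgh₀, hh₀A⟩ := hM g hg (η / 2) (by positivity)
  set f₀ := g - h₀ with hf₀
  have hf₀M : f₀ ∈ annih (L ⊔ M) :=
    mem_annih_sup.2 ⟨Submodule.sub_mem _ hg hh₀, fun x hx => by simp [hf₀, hgh₀ x hx]⟩
  let U : Set (StrongDual ℝ E) := {h | ‖h.comp A‖ < η / 2} ∩ {h | K * ‖n‖ < |(f₀ + h) n|}
  have hU : IsOpen U := by
    refine (isOpen_lt ?_ continuous_const).inter (isOpen_lt continuous_const ?_)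
    · fun_prop
    · fun_prop
  -- Adding B • k moves the value at n past K * ‖n‖ whatever f₀ n is, while k ∘ A is small enough to
  -- compensate for B.
  set B := |K| * ‖n‖ + |f₀ n| + 1 with hB
  have hB0 : 0 < B := by positivity
  obtain ⟨k, hk, hkn, hkA⟩ := hn (η / (2 * B)) (by positivity)
  have hh₁ : B • k ∈ annih (L ⊔ M) := Submodule.smul_mem _ _ hk
  have hh₁U : B • k ∈ U := by
    constructor
    · have h1 : (B • k).comp A = B • k.comp A := by ext; simp
      change ‖(B • k).comp A‖ < η / 2
      rw [h1, norm_smul, Real.norm_of_nonneg hB0.le]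
      calc B * ‖k.comp A‖ < B * (η / (2 * B)) := by gcongr
        _ = η / 2 := by field_simp
    · change K * ‖n‖ < |(f₀ + B • k) n|
      have h1 : (f₀ + B • k) n = f₀ n + B := by simp [hkn]
      rw [h1]
      have h2 := le_abs_self (f₀ n + B)
      have h3 := neg_abs_le (f₀ n)
      have h4 : K * ‖n‖ ≤ |K| * ‖n‖ := by gcongr; exact le_abs_self K
      linarith
  -- The other requirements are open in h, so transversality to the range of T* can be imposed on
  -- top of them.
  obtain ⟨h, hhU, hh, hhT⟩ : ∃ h ∈ U, h ∈ annih (L ⊔ M) ∧ f₀ + h ∉ adjointRangeSup T P := by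
    by_contra! hcon
    refine hT.not_annih_sup_le hL P hP M (le_of_isOpen_of_sub_mem hU hh₁U hh₁ fun x hx hxM => ?_)
    rw [← add_sub_add_left_eq_sub _ _ f₀]
    exact Submodule.sub_mem _ (hcon x hx hxM) (hcon _ hh₁U hh₁)
  refine ⟨f₀ + h, Submodule.add_mem _ hf₀M hh, ?_, hPT.sup_span hhT, n, hnP, hhU.2⟩
  have h1 : (f₀ + h - g).comp A = h.comp A - h₀.comp A := by
    ext x
    simp [hf₀]
    abel
  rw [h1]
  have h2 : ‖h.comp A‖ < η / 2 := hhU.1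
  exact (norm_sub_le _ _).trans_lt (by linarith)

theorem exists_sup_near {A : G →L[ℝ] E} {T : E →L[ℝ] F} {L : Submodule ℝ E}
    (hA : ∀ S : Submodule ℝ E, FiniteDimensional ℝ S → ∀ C : ℝ,
      ∃ h ∈ annih (L ⊔ S), C * ‖h.comp A‖ < ‖h‖)
    {P : Submodule ℝ (StrongDual ℝ E)} [FiniteDimensional ℝ P]
    (hPT : MeetsAdjointRangeTrivially T P) {M : Submodule ℝ E} [FiniteDimensional ℝ M]
    (hM : IsFreeFor A L M) {S : Set E} (hS : S.Finite) {η : ℝ} (hη : 0 < η) :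
    ∃ M' : Submodule ℝ E, M ≤ M' ∧ FiniteDimensional ℝ M' ∧ IsFreeFor A L M' ∧
      ∀ t ∈ S, ∃ y ∈ M', y ∈ coann P ∧ ‖T (t - y)‖ < η := by
  have := finiteDimensional_quotient_coann P
  induction S, hS using Set.Finite.induction_on with
  | empty => exact ⟨M, le_rfl, inferInstance, hM, by simp⟩
  | @insert t S _ _ ih =>
    obtain ⟨M', hMM', hfin, hfree, hy⟩ := ih
    obtain ⟨y₀, hy₀, hy₀t⟩ := hPT.exists_near t hη
    have hU : IsOpen {y | ‖T (t - y)‖ < η} := isOpen_lt (by fun_prop) continuous_const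
    obtain ⟨y, hyU, hyP, hysep⟩ := exists_isSeparatedFrom hA M' (coann P) hU hy₀t hy₀
    refine ⟨M' ⊔ Submodule.span ℝ {y}, hMM'.trans le_sup_left, inferInstance,
      hfree.sup_span hysep, ?_⟩
    rintro s (rfl | hs)
    · exact ⟨y, le_sup_right (a := M') (Submodule.mem_span_singleton_self y), hyP, hyU⟩
    · obtain ⟨z, hz, hz'⟩ := hy s hs
      exact ⟨z, le_sup_left (a := M') hz, hz'⟩

/-- A finite stage of the construction: the functionals chosen so far span `functionals`, all
later functionals vanish on `vectors`, and `targets` are the vectors whose images under `T` have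
to be approximated from the common kernel. -/
structure Stage (A : G →L[ℝ] E) (T : E →L[ℝ] F) (L : Submodule ℝ E) where
  functionals : Submodule ℝ (StrongDual ℝ E)
  vectors : Submodule ℝ E
  targets : Set E
  finite_functionals : FiniteDimensional ℝ functionals
  functionals_le : functionals ≤ annih L
  meets_trivially : MeetsAdjointRangeTrivially T functionals
  finite_vectors : FiniteDimensional ℝ vectors
  free : IsFreeFor A L vectors
  finite_targets : targets.Finite

/-- The empty stage. -/
def Stage.initial (A : G →L[ℝ] E) (T : E →L[ℝ] F) (L : Submodule ℝ E) : Stage A T L where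
  functionals := ⊥
  vectors := ⊥
  targets := ∅
  finite_functionals := inferInstance
  functionals_le := bot_le
  meets_trivially := fun _ h => h
  finite_vectors := inferInstance
  free := isFreeFor_bot A L
  finite_targets := Set.finite_empty

/-- The stage `s'` extends `s` by the functional `f` and the vector `x`, to accuracy `η`. -/
structure Stage.Extends {A : G →L[ℝ] E} {T : E →L[ℝ] F} {L : Submodule ℝ E} (s s' : Stage A T L)
    (g f : StrongDual ℝ E) (x : E) (η : ℝ) : Prop where
  functionals_le : s.functionals ≤ s'.functionals
  vectors_le : s.vectors ≤ s'.vectors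
  targets_subset : s.targets ⊆ s'.targets
  functional_mem : f ∈ s'.functionals
  vector_mem : x ∈ s'.vectors
  target_mem : x ∈ s'.targets
  functional_mem_annih : f ∈ annih s.vectors
  vector_mem_coann : x ∈ coann s.functionals
  apply_eq_one : f x = 1
  norm_sub_comp_le : ‖(f - g).comp A‖ ≤ η
  norm_mul_le : ‖x‖ * ‖f.comp A‖ ≤ η
  exists_near : ∀ t ∈ s'.targets, ∃ y ∈ s'.vectors, y ∈ coann s'.functionals ∧ ‖T (t - y)‖ ≤ η

theorem Stage.exists_extends {A : G →L[ℝ] E} {T : E →L[ℝ] F} {L : Submodule ℝ E}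
    (hA : ∀ S : Submodule ℝ E, FiniteDimensional ℝ S → ∀ C : ℝ,
      ∃ h ∈ annih (L ⊔ S), C * ‖h.comp A‖ < ‖h‖)
    (hT : HasKatoPropertyFor T L) (hL : IsClosed (L : Set E)) (s : Stage A T L)
    {g : StrongDual ℝ E} (hg : g ∈ annih L) {η : ℝ} (hη : 0 < η) :
    ∃ s' f x, s.Extends s' g f x η := by
  have := s.finite_functionals
  have := s.finite_vectors
  have := finiteDimensional_quotient_coann s.functionals
  -- With f x = 1 and K * ‖x‖ ≤ 1, the bound ‖f ∘ A‖ ≤ ‖g ∘ A‖ + η yields ‖x‖ * ‖f ∘ A‖ ≤ η.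
  set K := (‖g.comp A‖ + η) / η with hK
  have hK0 : 0 < K := by positivity
  obtain ⟨f, hf, hfg, hfT, n, hn, hfn⟩ := exists_functional_near hA hT hL s.functionals_le
    s.meets_trivially s.free hg hη K
  rw [mem_annih_sup] at hf
  have hU : IsOpen {x | K * ‖x‖ < |f x|} := isOpen_lt (by fun_prop) (by fun_prop)
  obtain ⟨u, huU, hu, husep⟩ := exists_isSeparatedFrom hA s.vectors (coann s.functionals) hU hfn hn
  have huU' : K * ‖u‖ < |f u| := huU
  have hfu : f u ≠ 0 := abs_pos.1 (lt_of_le_of_lt (by positivity) huU')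
  set x := (f u)⁻¹ • u with hx
  have hxsep : IsSeparatedFrom A L s.vectors x := husep.smul (inv_ne_zero hfu)
  obtain ⟨M', hM', hfin, hfree, hnear⟩ := exists_sup_near hA hfT (s.free.sup_span hxsep)
    (s.finite_targets.insert x) hη
  have hxK : K * ‖x‖ ≤ 1 := by
    rw [hx, norm_smul, norm_inv, Real.norm_eq_abs, mul_left_comm, inv_mul_le_iff₀ (abs_pos.2 hfu)]
    linarith
  have hfA : ‖f.comp A‖ ≤ ‖g.comp A‖ + η := by
    have h1 : f.comp A = g.comp A + (f - g).comp A := by ext; simp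
    rw [h1]
    exact (norm_add_le _ _).trans (by linarith)
  refine ⟨⟨s.functionals ⊔ Submodule.span ℝ {f}, M', insert x s.targets, inferInstance,
    sup_le s.functionals_le ?_, hfT, hfin, hfree, s.finite_targets.insert x⟩, f, x, ?_⟩
  · rw [Submodule.span_singleton_le_iff_mem]; exact hf.1
  exact
    { functionals_le := le_sup_left
      vectors_le := le_sup_left.trans hM'
      targets_subset := Set.subset_insert _ _
      functional_mem := le_sup_right (a := s.functionals) (Submodule.mem_span_singleton_self f)
      vector_mem := hM' (le_sup_right (a := s.vectors) (Submodule.mem_span_singleton_self x))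
      target_mem := Set.mem_insert _ _
      functional_mem_annih := hf.2
      vector_mem_coann := Submodule.smul_mem _ _ hu
      apply_eq_one := by simp [hx, hfu]
      norm_sub_comp_le := hfg.le
      norm_mul_le := by
        calc ‖x‖ * ‖f.comp A‖ ≤ ‖x‖ * (‖g.comp A‖ + η) := by gcongr
          _ = η * (K * ‖x‖) := by rw [hK]; field_simp
          _ ≤ η * 1 := by gcongr
          _ = η := mul_one η
      exists_near := fun t ht => by
        obtain ⟨y, hy, hyP, hlt⟩ := hnear t ht
        exact ⟨y, hy, hyP, hlt.le⟩ }

/-- The biorthogonal system underlying the construction. -/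
theorem exists_biorthogonal_system {A : G →L[ℝ] E} {T : E →L[ℝ] F} {L : Submodule ℝ E}
    (hA : ∀ S : Submodule ℝ E, FiniteDimensional ℝ S → ∀ C : ℝ,
      ∃ h ∈ annih (L ⊔ S), C * ‖h.comp A‖ < ‖h‖)
    (hT : HasKatoPropertyFor T L) (hL : IsClosed (L : Set E))
    {g : ℕ → StrongDual ℝ E} (hg : ∀ n, g n ∈ annih L) {η : ℕ → ℝ} (hη : ∀ n, 0 < η n) :
    ∃ (f : ℕ → StrongDual ℝ E) (x : ℕ → E), (∀ n, f n ∈ annih L) ∧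
      (∀ m n, f m (x n) = if m = n then 1 else 0) ∧
      (∀ n, ‖(f n - g n).comp A‖ ≤ η n) ∧ (∀ n, ‖x n‖ * ‖(f n).comp A‖ ≤ η n) ∧
      ∀ m n, m ≤ n → ∃ y, (∀ k, f k y = 0) ∧ ‖T (x m - y)‖ ≤ η n := by
  choose next f x hext using fun (s : Stage A T L) (n : ℕ) => s.exists_extends hA hT hL (hg n) (hη n)
  let s : ℕ → Stage A T L := fun n => Nat.rec (Stage.initial A T L) (fun n s => next s n) n
  have hs : ∀ n, (s n).Extends (s (n + 1)) (g n) (f (s n) n) (x (s n) n) (η n) :=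
    fun n => hext (s n) n
  have hP : Monotone fun n => (s n).functionals := monotone_nat_of_le_succ fun n =>
    (hs n).functionals_le
  have hM : Monotone fun n => (s n).vectors := monotone_nat_of_le_succ fun n => (hs n).vectors_le
  have hS : Monotone fun n => (s n).targets := monotone_nat_of_le_succ fun n =>
    (hs n).targets_subset
  -- Functionals chosen before stage n vanish on y through `coann`, later ones because they kill the
  -- stored vectors.
  have hkill : ∀ n, ∀ y ∈ (s n).vectors, y ∈ coann (s n).functionals →
      ∀ k, f (s k) k y = 0 := by
    intro n y hy hyP k
    rcases lt_or_ge k n with hk | hk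
    · exact hyP _ (hP (Nat.succ_le_of_lt hk) (hs k).functional_mem)
    · exact (hs k).functional_mem_annih y (hM hk hy)
  refine ⟨fun n => f (s n) n, fun n => x (s n) n, fun n => (s (n + 1)).functionals_le
    (hs n).functional_mem, fun m n => ?_, fun n => (hs n).norm_sub_comp_le,
    fun n => (hs n).norm_mul_le, fun m n hmn => ?_⟩
  · rcases lt_trichotomy m n with h | rfl | h
    · rw [if_neg h.ne]
      exact (hs n).vector_mem_coann _ (hP (Nat.succ_le_of_lt h) (hs m).functional_mem)
    · rw [if_pos rfl]
      exact (hs m).apply_eq_one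
    · rw [if_neg h.ne']
      exact (hs m).functional_mem_annih _ (hM (Nat.succ_le_of_lt h) (hs n).vector_mem)
  · obtain ⟨y, hy, hyP, hle⟩ := (hs n).exists_near _ (hS (Nat.succ_le_succ hmn) (hs m).target_mem)
    exact ⟨y, hkill (n + 1) y hy hyP, hle⟩

end Construction

/-! ### Separability and dimension of the quotient; a countable separating family. -/

section Quotient

variable {E : Type u} {F : Type v} [NormedAddCommGroup E] [NormedSpace ℝ E]
  [NormedAddCommGroup F] [NormedSpace ℝ F]

theorem separableSpace_quotient_of_dense_sup_span {N : Submodule ℝ E} {x : ℕ → E}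
    (h : Dense ((N ⊔ Submodule.span ℝ (Set.range x) : Submodule ℝ E) : Set E)) :
    TopologicalSpace.SeparableSpace (E ⧸ N) := by
  have h1 : TopologicalSpace.IsSeparable
      ((Submodule.span ℝ (Set.range fun n => N.mkQ (x n)) : Submodule ℝ (E ⧸ N)) :
        Set (E ⧸ N)) :=
    (Set.countable_range _).isSeparable.span
  have h2 : Dense (N.mkQ '' ((N ⊔ Submodule.span ℝ (Set.range x) : Submodule ℝ E) : Set E)) :=
    (N.mkQ_surjective.denseRange).dense_image N.mkQL.continuous h
  have h3 : N.mkQ '' ((N ⊔ Submodule.span ℝ (Set.range x) : Submodule ℝ E) : Set E) =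
      (Submodule.span ℝ (Set.range fun n => N.mkQ (x n)) : Submodule ℝ (E ⧸ N)) := by
    rw [← Submodule.map_coe, Submodule.map_sup, Submodule.mkQ_map_self, bot_sup_eq,
      Submodule.map_span, ← Set.range_comp]
    rfl
  rw [← TopologicalSpace.isSeparable_univ_iff, ← h2.closure_eq, h3]
  exact h1.closure

theorem not_finiteDimensional_quotient_of_biorthogonal {N : Submodule ℝ E}
    {f : ℕ → StrongDual ℝ E} {x : ℕ → E} (hN : ∀ y ∈ N, ∀ n, f n y = 0)
    (hfx : ∀ m n, f m (x n) = if m = n then 1 else 0) : ¬ FiniteDimensional ℝ (E ⧸ N) := by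
  intro hfin
  have hli : LinearIndependent ℝ fun n => N.mkQ (x n) := by
    rw [linearIndependent_iff']
    intro s c hc j hj
    have h1 : ∑ i ∈ s, c i • x i ∈ N := by
      rw [← Submodule.Quotient.mk_eq_zero N, ← Submodule.mkQ_apply, map_sum]
      simpa using hc
    have h2 := hN _ h1 j
    simpa [hfx, hj] using h2
  exact not_finite_iff_infinite.2 (inferInstance : Infinite ℕ) hli.finite

/-- A sequence of functionals vanishing on `L` and separating the points outside `L` from `0`. -/
theorem exists_seq_annih_separating {L : Submodule ℝ E} (hL : IsClosed (L : Set E))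
    (hsep : TopologicalSpace.SeparableSpace (WeakDual ℝ (E ⧸ L))) :
    ∃ g : ℕ → StrongDual ℝ E, (∀ n, g n ∈ annih L) ∧ ∀ x, (∀ n, g n x = 0) → x ∈ L := by
  have : IsClosed (L : Set E) := hL
  let d : ℕ → WeakDual ℝ (E ⧸ L) := TopologicalSpace.denseSeq _
  let q : E →L[ℝ] E ⧸ L := L.mkQL
  refine ⟨fun n => (WeakDual.toStrongDual (d n)).comp q, fun n x hx => ?_, fun x hx => ?_⟩
  · have : q x = 0 := (Submodule.Quotient.mk_eq_zero _).2 hx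
    simp [this]
  · by_contra hxL
    have hne : q x ≠ 0 := fun h0 => hxL ((Submodule.Quotient.mk_eq_zero _).1 h0)
    obtain ⟨φ, -, hφ⟩ := exists_dual_vector ℝ (q x) (norm_ne_zero_iff.2 hne)
    have hopen : IsOpen {ψ : WeakDual ℝ (E ⧸ L) | ψ (q x) ≠ 0} :=
      isOpen_ne_fun (WeakDual.eval_continuous (q x)) continuous_const
    obtain ⟨_, hψ, n, rfl⟩ := (TopologicalSpace.denseRange_denseSeq
      (WeakDual ℝ (E ⧸ L))).inter_open_nonempty _ hopen
      ⟨StrongDual.toWeakDual φ, by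
        change φ (q x) ≠ 0
        rw [hφ]
        simpa using hne⟩
    exact hψ (hx n)

end Quotient

/-! ### Assembly of the subspace E₁. -/

theorem theorem4p1 {E : Type u} {F : Type v}
    [NormedAddCommGroup E] [NormedSpace ℝ E] [CompleteSpace E]
    [NormedAddCommGroup F] [NormedSpace ℝ F] [CompleteSpace F]
    (L : Submodule ℝ E) (hL : IsClosed (L : Set E))
    (T : E →L[ℝ] F) (hT : HasKatoPropertyFor T L)
    (R : Submodule ℝ E) (hR : IsProperDenseOperatorRange R)
    (hRL : R ⊓ L = ⊥)
    (hsep : TopologicalSpace.SeparableSpace (WeakDual ℝ (E ⧸ L))) :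
    ∃ E₁ : Submodule ℝ E, IsClosed (E₁ : Set E) ∧
      L ≤ E₁ ∧
      TopologicalSpace.SeparableSpace (E ⧸ E₁) ∧
      ¬ FiniteDimensional ℝ (E ⧸ E₁) ∧
      E₁ ⊓ R = ⊥ ∧
      closure (T '' (E₁ : Set E)) = closure (Set.range T) := by
  obtain ⟨⟨G, _, _, _, A, rfl⟩, hdense, hne⟩ := hR
  have hA : ∀ S : Submodule ℝ E, FiniteDimensional ℝ S → ∀ C : ℝ,
      ∃ h ∈ annih (L ⊔ S), C * ‖h.comp A‖ < ‖h‖ := fun S _ C =>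
    exists_norm_comp_lt A L hL hdense hne hRL S C
  obtain ⟨g, hgL, hg⟩ := exists_seq_annih_separating hL hsep
  -- Unpairing makes every g i a target at the infinitely many indices `Nat.pair i k`.
  obtain ⟨f, x, hfL, hfx, hfg, hxf, hy⟩ := exists_biorthogonal_system (A := A) hA hT hL
    (g := fun n => g n.unpair.1) (fun n => hgL _) (η := fun n => (1 / 2 : ℝ) ^ n)
    (fun n => by positivity)
  have hη : Tendsto (fun n : ℕ => (1 / 2 : ℝ) ^ n) atTop (𝓝 0) :=
    tendsto_pow_atTop_nhds_zero_of_lt_one (by norm_num) (by norm_num)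
  set E₁ := coann (Submodule.span ℝ (Set.range f)) with hE₁
  have hmem : ∀ y, y ∈ E₁ ↔ ∀ n, f n y = 0 := by
    intro y
    constructor
    · exact fun h n => h _ (Submodule.subset_span ⟨n, rfl⟩)
    · intro h φ hφ
      induction hφ using Submodule.span_induction with
      | mem φ hφ => obtain ⟨n, rfl⟩ := hφ; exact h n
      | zero => simp
      | add φ ψ _ _ h₁ h₂ => simp [h₁, h₂]
      | smul c φ _ h => simp [h]
  have hclosed : IsClosed (E₁ : Set E) := isClosed_coann _
  set X := Submodule.span ℝ (Set.range x) with hX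
  have hdenseX : Dense ((E₁ ⊔ X : Submodule ℝ E) : Set E) := by
    refine dense_closure.1 (hdense.mono ?_)
    rintro _ ⟨a, rfl⟩
    have hbd : ∀ n, ‖f n (A a) • x n‖ ≤ ‖a‖ * (1 / 2 : ℝ) ^ n := by
      intro n
      have h1 := ((f n).comp A).le_opNorm a
      rw [norm_smul]
      calc ‖f n (A a)‖ * ‖x n‖ ≤ ‖(f n).comp A‖ * ‖a‖ * ‖x n‖ := by gcongr; exact h1
        _ = ‖a‖ * (‖x n‖ * ‖(f n).comp A‖) := by ring
        _ ≤ ‖a‖ * (1 / 2 : ℝ) ^ n := by gcongr; exact hxf n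
    have hsum : Summable fun n => f n (A a) • x n :=
      Summable.of_norm_bounded (summable_geometric_two.mul_left _) hbd
    have hz : A a - ∑' n, f n (A a) • x n ∈ E₁ := by
      rw [hmem]
      intro m
      rw [map_sub, (f m).map_tsum hsum, tsum_eq_single m fun n hn => by
        simp [hfx, hn.symm]]
      simp [hfx]
    have hlim : Tendsto (fun n => (A a - ∑' n, f n (A a) • x n) +
        ∑ i ∈ Finset.range n, f i (A a) • x i) atTop (𝓝 (A a)) := by
      have := hsum.hasSum.tendsto_sum_nat.const_add (A a - ∑' n, f n (A a) • x n)
      rwa [sub_add_cancel] at this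
    refine mem_closure_of_tendsto hlim (Eventually.of_forall fun n => ?_)
    exact Submodule.add_mem_sup hz (X.sum_mem fun i _ => X.smul_mem _
      (Submodule.subset_span ⟨i, rfl⟩))
  refine ⟨E₁, hclosed, ?_, separableSpace_quotient_of_dense_sup_span hdenseX,
    not_finiteDimensional_quotient_of_biorthogonal (fun y hy => (hmem y).1 hy) hfx, ?_, ?_⟩
  · exact fun y hy => (hmem y).2 fun n => hfL n y hy
  · rw [eq_bot_iff, ← hRL]
    rintro _ ⟨hr, a, rfl⟩
    refine ⟨⟨a, rfl⟩, hg _ fun n => ?_⟩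
    have hbd : ∀ k, ‖g n (A a)‖ ≤ (1 / 2 : ℝ) ^ Nat.pair n k * ‖a‖ := by
      intro k
      have h1 := ((f (Nat.pair n k) - g (Nat.pair n k).unpair.1).comp A).le_of_opNorm_le
        (hfg _) a
      have h2 := (hmem _).1 hr (Nat.pair n k)
      simp only [ContinuousLinearMap.coe_coe] at h2
      simpa [h2] using h1
    have hlim : Tendsto (fun k => (1 / 2 : ℝ) ^ Nat.pair n k * ‖a‖) atTop (𝓝 0) := by
      have h1 : Tendsto (fun k => Nat.pair n k) atTop atTop :=
        tendsto_atTop_mono (fun k => Nat.right_le_pair n k) tendsto_id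
      simpa using (hη.comp h1).mul_const ‖a‖
    exact norm_le_zero_iff.1 (ge_of_tendsto' hlim hbd)
  · refine subset_antisymm (closure_mono (Set.image_subset_range _ _)) ?_
    refine closure_minimal ?_ isClosed_closure
    let N : Submodule ℝ F := (E₁.map (T : E →ₗ[ℝ] F)).topologicalClosure
    have hN : (N : Set F) = closure (T '' (E₁ : Set E)) := by
      simp [N, Submodule.topologicalClosure_coe]
    rw [← hN]
    have hxN : ∀ m, T (x m) ∈ N := by
      intro m
      choose! y hyE hyT using fun n => hy m n
      have hdist : Tendsto (fun n => T (x m) - T (x m - y n)) atTop (𝓝 (T (x m) - 0)) := by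
        refine tendsto_const_nhds.sub (squeeze_zero_norm' ?_ hη)
        filter_upwards [eventually_ge_atTop m] with n hn using hyT n hn
      rw [sub_zero] at hdist
      rw [← SetLike.mem_coe, hN]
      refine mem_closure_of_tendsto hdist ?_
      filter_upwards [eventually_ge_atTop m] with n hn
      exact ⟨y n, (hmem _).2 (hyE n hn), by simp⟩
    have hle : E₁ ⊔ X ≤ N.comap (T : E →ₗ[ℝ] F) := by
      refine sup_le ?_ (Submodule.span_le.2 ?_)
      · exact fun y hy => Submodule.le_topologicalClosure _ ⟨y, hy, rfl⟩
      · rintro _ ⟨m, rfl⟩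
        exact hxN m
    rintro _ ⟨z, rfl⟩
    have hpre : IsClosed (T ⁻¹' (N : Set F)) :=
      (Submodule.isClosed_topologicalClosure _).preimage T.continuous
    have hz : z ∈ closure ((E₁ ⊔ X : Submodule ℝ E) : Set E) := hdenseX z
    exact closure_minimal (fun y hy => hle hy) hpre hz
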